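/- Let $X$ be a locally finite partially ordered set and let $F$ be a field. Let $A = I(X,F)$ be the incidence algebra: the $F$-algebra of all functions $f\colon X\times X\to F$ with $f(x,y)=0$ unless $x\le y$, with pointwise addition and scalar multiplication and product $(fg)(x,y)=\sum_{x\le z\le y} f(x,z)g(z,y)$. Let $C = \mathrm{Co}(X,F)$ be the incidence coalgebra: the $F$-space with basis the intervals $[x,y]$, $x\le y$, comultiplication $\Delta([x,y])=\sum_{x\le z\le y}[x,z]\otimes[z,y]$, and counit $\varepsilon([x,x])=1$, $\varepsilon([x,y])=0$ for $x\neq y$. Denote by $\mathrm{Aut}\,A$ the group of $F$-algebra automorphisms of $A$ and by $\mathrm{Aut}\,C$ the group of coalgebra automorphisms of $C$, both under composition. Let $C^*$ be the dual algebra of $C$, whose product is $(\chi\circ\xi)(c)=\sum_i\chi(a_i)\xi(b_i)$ if $\Delta(c)=\sum_i a_i\otimes b_i$, and for $\varphi\in\mathrm{Aut}\,C$ let $\varphi^*(\chi)=\chi\varphi$. For $f\in A$ let $\Psi(f)\in C^*$ be the functional with $\Psi(f)([x,y])=f(x,y)$, and define $\Theta$ on $\mathrm{Aut}\,C$ by $(\Theta(\varphi)(f))(x,y)=\Psi(f)(\varphi([x,y]))$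 for $x\le y$; this defines an antihomomorphism of groups $\Theta\colon\mathrm{Aut}\,C\to\mathrm{Aut}\,A$. Define the following subgroups of $\mathrm{Aut}\,C$. - $\mathrm{In}(\mathrm{Aut}\,C)$: all $\nu$ such that $\nu^*$ is an inner automorphism $\chi\mapsto v^{-1}\circ\chi\circ v$ of $C^*$. - $\mathrm{In}_1(\mathrm{Aut}\,C)$: all $\nu$ such that $\Theta(\nu)$ is an inner automorphism $f\mapsto v^{-1}fv$ of $A$ with $v$ an invertible element of the form $1+g$, where $g\in A$ and $g(x,x)=0$ for all $x\in X$. - $\mathrm{Mult}\,C$: all $\lambda$ with $\lambda([x,x])=[x,x]$ for all $x$ and $\lambda([x,y])=d_{xy}[x,y]$ for all $x<y$, for some nonzero elements $d_{xy}\in F$ ($x<y$) satisfying $d_{xy}=d_{xz}d_{zy}$ whenever $x<z<y$. - $\mathrm{Aut}_C X$: all automorphisms of the form $[x,y]\mapsto[\tau(x),\tau(y)]$, where $\tau$ is an automorphism of the partially ordered set $X$. For subgroups $N,H$ of a group, write $K=N\rtimes H$ if $K$ is a subgroup containing $N$ and $H$, $N$ is normal in $K$, and every element of $K$ is uniquely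 of the form $nh$ with $n\in N$, $h\in H$. Then the following hold. 1. The product set $\mathrm{In}(\mathrm{Aut}\,C)\cdot\mathrm{Mult}\,C$ is a subgroup of $\mathrm{Aut}\,C$, and $$\mathrm{Aut}\,C=(\mathrm{In}(\mathrm{Aut}\,C)\cdot\mathrm{Mult}\,C)\rtimes\mathrm{Aut}_C X=\mathrm{In}_1(\mathrm{Aut}\,C)\rtimes\mathrm{Mult}\,C\rtimes\mathrm{Aut}_C X.$$ Here $\mathrm{In}(\mathrm{Aut}\,C)\cdot\mathrm{Mult}\,C=\mathrm{In}_1(\mathrm{Aut}\,C)\rtimes\mathrm{Mult}\,C$, and the last expression is valid with either bracketing. 2. The mapping $\Theta\colon\mathrm{Aut}\,C\to\mathrm{Aut}\,A$ is an anti-isomorphism of groups; in particular $\mathrm{Aut}\,C$ and $\mathrm{Aut}\,A$ are anti-isomorphic. -/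

import Mathlib

open scoped TensorProduct Pointwise

noncomputable section

/-! ## Automorphisms of coalgebras, dual algebras, inner automorphisms -/

/-- The automorphism group of a coalgebra: bijective coalgebra endomorphisms under composition. -/
instance CoalgEquiv.instAutGroup {R C : Type*} [CommSemiring R] [AddCommMonoid C] [Module R C]
    [CoalgebraStruct R C] : Group (C ≃ₗc[R] C) where
  mul f g := g.trans f
  one := CoalgEquiv.refl R C
  inv f := f.symm
  mul_assoc _ _ _ := rfl
  one_mul _ := rfl
  mul_one _ := rfl
  inv_mul_cancel f := CoalgEquiv.ext fun c => f.symm_apply_apply c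

/-- The dual algebra `C^*` of a coalgebra `C`, with the convolution product
`(χ ∘ ξ)(c) = ∑ χ(aᵢ) ξ(bᵢ)` when `Δ(c) = ∑ aᵢ ⊗ bᵢ`, and with unit the counit of `C`. -/
abbrev DualAlg (F C : Type*) [CommSemiring F] [AddCommMonoid C] [Module F C] [Coalgebra F C] :=
  WithConv (C →ₗ[F] F)

/-- The automorphism `φ^*` of the dual algebra, `φ^*(χ) = χ ∘ φ`. -/
def dualAlgEquiv {F C : Type*} [Field F] [AddCommGroup C] [Module F C] [Coalgebra F C]
    (φ : C ≃ₗc[F] C) : DualAlg F C ≃ₐ[F] DualAlg F C where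
  toFun χ := WithConv.toConv (χ.ofConv ∘ₗ (φ : C →ₗc[F] C).toLinearMap)
  invFun χ := WithConv.toConv (χ.ofConv ∘ₗ (φ.symm : C →ₗc[F] C).toLinearMap)
  left_inv χ := by ext c; simp
  right_inv χ := by ext c; simp
  map_mul' χ ξ := by
    have := LinearMap.convMul_comp_coalgHom_distrib χ ξ (φ : C →ₗc[F] C)
    rw [this]
  map_add' χ ξ := rfl
  commutes' r := by ext c; simp

@[simp] theorem dualAlgEquiv_apply {F C : Type*} [Field F] [AddCommGroup C] [Module F C]
    [Coalgebra F C] (φ : C ≃ₗc[F] C) (χ : DualAlg F C) (c : C) :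
    dualAlgEquiv φ χ c = χ (φ c) := rfl

/-- The antihomomorphism `Γ : Aut C → Aut C^*`, `φ ↦ φ^*`, as a homomorphism into the opposite
group. -/
def dualAut (F C : Type*) [Field F] [AddCommGroup C] [Module F C] [Coalgebra F C] :
    (C ≃ₗc[F] C) →* (DualAlg F C ≃ₐ[F] DualAlg F C)ᵐᵒᵖ where
  toFun φ := MulOpposite.op (dualAlgEquiv φ)
  map_one' := rfl
  map_mul' _ _ := rfl

/-- `In(Aut A)`: the group of inner automorphisms `f ↦ v⁻¹ f v` of an algebra `A`. -/
def innerAut (F A : Type*) [CommSemiring F] [Semiring A] [Algebra F A] :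
    Subgroup (A ≃ₐ[F] A) where
  carrier := {μ | ∃ v : Aˣ, ∀ f, μ f = ↑v⁻¹ * f * ↑v}
  one_mem' := ⟨1, fun f => by simp⟩
  mul_mem' := by
    rintro μ ν ⟨v, hv⟩ ⟨w, hw⟩
    exact ⟨w * v, fun f => by simp [hv, hw, mul_assoc]⟩
  inv_mem' := by
    rintro μ ⟨v, hv⟩
    refine ⟨v⁻¹, fun f => ?_⟩
    apply μ.injective
    have h : μ (μ⁻¹ f) = f := by rw [← AlgEquiv.mul_apply, mul_inv_cancel, AlgEquiv.one_apply]
    rw [h, hv]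
    simp [mul_assoc]

/-- `In(Aut C)`: the automorphisms `ν` of the coalgebra `C` for which `ν^*` is an inner
automorphism of the dual algebra `C^*`. -/
def innerCoalgAut (F C : Type*) [Field F] [AddCommGroup C] [Module F C] [Coalgebra F C] :
    Subgroup (C ≃ₗc[F] C) :=
  (innerAut F (DualAlg F C)).op.comap (dualAut F C)

/-! ## Internal semidirect products -/

/-- `K = N ⋊ H` inside a group `G`: the subgroups `N`, `H` lie in `K`, `N` is normal in `K`, and
every element of `K` is uniquely a product of an element of `N` and an element of `H`. -/
structure IsInternalSemidirect {G : Type*} [Group G] (K N H : Subgroup G) : Prop where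
  left_le : N ≤ K
  right_le : H ≤ K
  normal : (N.subgroupOf K).Normal
  isComplement : (N.subgroupOf K).IsComplement' (H.subgroupOf K)

/-! ## The incidence coalgebra -/

/-- The underlying space of the incidence coalgebra `Co(X,F)`: the `F`-space with basis the
(nonempty) intervals `[x,y]`, `x ≤ y`, of `X`. -/
def IncidenceCoalgebra (F X : Type*) [Field F] [PartialOrder X] : Type _ :=
  NonemptyInterval X →₀ F

namespace IncidenceCoalgebra

section Space

variable (F X : Type*) [Field F] [PartialOrder X]

instance : AddCommGroup (IncidenceCoalgebra F X) :=
  inferInstanceAs (AddCommGroup (NonemptyInterval X →₀ F))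

instance : Module F (IncidenceCoalgebra F X) :=
  inferInstanceAs (Module F (NonemptyInterval X →₀ F))

/-- The defining basis of `Co(X,F)`, consisting of the intervals of `X`. -/
def basis : Module.Basis (NonemptyInterval X) F (IncidenceCoalgebra F X) :=
  .ofRepr (LinearEquiv.refl F (NonemptyInterval X →₀ F))

variable {X}

open Classical in
/-- The basis vector `[x,y]` of `Co(X,F)` for `x ≤ y`. When `x ≤ y` fails the interval is empty and
is not a basis vector; the value is then `0` by convention. -/
def interval (x y : X) : IncidenceCoalgebra F X :=
  if h : x ≤ y then basis F X ⟨(x, y), h⟩ else 0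

theorem interval_of_le {x y : X} (h : x ≤ y) : interval F x y = basis F X ⟨(x, y), h⟩ :=
  dif_pos h

variable {F}

theorem linearMap_ext {M : Type*} [AddCommGroup M] [Module F M]
    {f g : IncidenceCoalgebra F X →ₗ[F] M}
    (h : ∀ x y : X, x ≤ y → f (interval F x y) = g (interval F x y)) : f = g := by
  refine (basis F X).ext fun I => ?_
  have := h I.fst I.snd I.fst_le_snd
  rwa [interval_of_le F I.fst_le_snd] at this

end Space

section Coalg

variable (F X : Type*) [Field F] [PartialOrder X] [LocallyFiniteOrder X] [DecidableEq X]

/-- `Δ([x,y]) = ∑_{x ≤ z ≤ y} [x,z] ⊗ [z,y]`; `ε([x,x]) = 1` and `ε([x,y]) = 0` for `x ≠ y`. -/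
instance : CoalgebraStruct F (IncidenceCoalgebra F X) where
  comul := (basis F X).constr F fun I =>
    ∑ z ∈ Finset.Icc I.fst I.snd, interval F I.fst z ⊗ₜ[F] interval F z I.snd
  counit := (basis F X).constr F fun I => if I.fst = I.snd then 1 else 0

variable {X}

theorem comul_interval {x y : X} (h : x ≤ y) :
    CoalgebraStruct.comul (R := F) (interval F x y) =
      ∑ z ∈ Finset.Icc x y, interval F x z ⊗ₜ[F] interval F z y := by
  rw [interval_of_le F h]
  exact (basis F X).constr_basis F _ _

theorem counit_interval {x y : X} (h : x ≤ y) :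
    CoalgebraStruct.counit (R := F) (interval F x y) = if x = y then 1 else 0 := by
  rw [interval_of_le F h]
  exact (basis F X).constr_basis F _ _

instance : Coalgebra F (IncidenceCoalgebra F X) where
  coassoc := by
    refine linearMap_ext fun x y h => ?_
    simp only [LinearMap.comp_apply, comul_interval F h, map_sum, LinearMap.rTensor_tmul,
      LinearMap.lTensor_tmul, LinearEquiv.coe_coe]
    have h1 : ∀ z ∈ Finset.Icc x y,
        (TensorProduct.assoc F _ _ _)
          (CoalgebraStruct.comul (R := F) (interval F x z) ⊗ₜ[F] interval F z y) =
        ∑ w ∈ Finset.Icc x z, interval F x w ⊗ₜ[F] (interval F w z ⊗ₜ[F] interval F z y) := by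
      intro z hz
      rw [comul_interval F (Finset.mem_Icc.1 hz).1, TensorProduct.sum_tmul, map_sum]
      simp
    have h2 : ∀ w ∈ Finset.Icc x y,
        interval F x w ⊗ₜ[F] CoalgebraStruct.comul (R := F) (interval F w y) =
        ∑ z ∈ Finset.Icc w y, interval F x w ⊗ₜ[F] (interval F w z ⊗ₜ[F] interval F z y) := by
      intro w hw
      rw [comul_interval F (Finset.mem_Icc.1 hw).2, TensorProduct.tmul_sum]
    rw [Finset.sum_congr rfl h1, Finset.sum_congr rfl h2]
    refine Finset.sum_comm' fun z w => ?_
    simp only [Finset.mem_Icc]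
    exact ⟨fun ⟨⟨_, b⟩, c, d⟩ => ⟨⟨d, b⟩, c, d.trans b⟩,
      fun ⟨⟨a, b⟩, c, _⟩ => ⟨⟨c.trans a, b⟩, c, a⟩⟩
  rTensor_counit_comp_comul := by
    refine linearMap_ext fun x y h => ?_
    simp only [LinearMap.comp_apply, comul_interval F h, map_sum, LinearMap.rTensor_tmul,
      TensorProduct.mk_apply]
    rw [Finset.sum_eq_single_of_mem x (Finset.left_mem_Icc.2 h)]
    · simp [counit_interval F le_rfl]
    · intro z hz hzx
      rw [counit_interval F (Finset.mem_Icc.1 hz).1, if_neg hzx.symm, TensorProduct.zero_tmul]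
  lTensor_counit_comp_comul := by
    refine linearMap_ext fun x y h => ?_
    simp only [LinearMap.comp_apply, comul_interval F h, map_sum, LinearMap.lTensor_tmul,
      LinearMap.flip_apply, TensorProduct.mk_apply]
    rw [Finset.sum_eq_single_of_mem y (Finset.right_mem_Icc.2 h)]
    · simp [counit_interval F le_rfl]
    · intro z hz hzy
      rw [counit_interval F (Finset.mem_Icc.1 hz).2, if_neg hzy, TensorProduct.tmul_zero]

variable (X)

/-! ## The dual algebra of `Co(X,F)` and the incidence algebra `I(X,F)` -/

/-- The isomorphism of algebras `Φ : C^* → I(X,F)`, `Φ(χ)(x,y) = χ([x,y])` for `x ≤ y`. Its inverse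
`Ψ` satisfies `Ψ(f)([x,y]) = f(x,y)`. -/
def dualEquiv : DualAlg F (IncidenceCoalgebra F X) ≃ₐ[F] IncidenceAlgebra F X where
  toFun χ := ⟨fun x y => χ (interval F x y), fun x y h => by simp [interval, h]⟩
  invFun f := WithConv.toConv ((basis F X).constr F fun I => f I.fst I.snd)
  left_inv χ := by
    refine WithConv.ofConv_injective (linearMap_ext fun x y h => ?_)
    rw [interval_of_le F h]
    refine ((basis F X).constr_basis F _ _).trans ?_
    exact congrArg χ (interval_of_le F h)
  right_inv f := by
    refine IncidenceAlgebra.ext fun x y h => ?_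
    change ((basis F X).constr F fun I => f I.fst I.snd) (interval F x y) = f x y
    rw [interval_of_le F h]
    exact (basis F X).constr_basis F _ _
  map_mul' χ ξ := by
    refine IncidenceAlgebra.ext fun x y h => ?_
    rw [IncidenceAlgebra.mul_apply]
    change (χ * ξ) (interval F x y) = ∑ z ∈ Finset.Icc x y, χ (interval F x z) * ξ (interval F z y)
    rw [LinearMap.convMul_apply, comul_interval F h]
    simp
  map_add' χ ξ := rfl
  commutes' r := by
    refine IncidenceAlgebra.ext fun x y h => ?_
    change algebraMap F (DualAlg F (IncidenceCoalgebra F X)) r (interval F x y) = _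
    rw [LinearMap.convAlgebraMap_apply, counit_interval F h,
      Algebra.algebraMap_eq_smul_one (A := IncidenceAlgebra F X),
      IncidenceAlgebra.constSMul_apply, IncidenceAlgebra.one_apply]
    simp

/-- The antihomomorphism `Θ : Aut C → Aut A`, `Θ(φ) = Φ φ^* Ψ`, where `C = Co(X,F)` and
`A = I(X,F)`, as a homomorphism into the opposite group. -/
def Theta : (IncidenceCoalgebra F X ≃ₗc[F] IncidenceCoalgebra F X) →*
    (IncidenceAlgebra F X ≃ₐ[F] IncidenceAlgebra F X)ᵐᵒᵖ :=
  (MulEquiv.op (AlgEquiv.autCongr (dualEquiv F X))).toMonoidHom.comp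
    (dualAut F (IncidenceCoalgebra F X))

/-- `(Θ(φ)(f))(x,y) = Ψ(f)(φ([x,y]))` for `x ≤ y`. -/
theorem Theta_apply (φ : IncidenceCoalgebra F X ≃ₗc[F] IncidenceCoalgebra F X)
    (f : IncidenceAlgebra F X) (x y : X) :
    (Theta F X φ).unop f x y = (dualEquiv F X).symm f (φ (interval F x y)) := rfl

/-! ## The subgroups of `Aut I(X,F)` and `Aut Co(X,F)` -/

/-- `In₁(Aut A)`: the group of inner automorphisms `f ↦ v⁻¹ f v` of `A = I(X,F)` with `v` of the
form `1 + g`, where `g(x,x) = 0` for all `x`. -/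
def innerAutOne : Subgroup (IncidenceAlgebra F X ≃ₐ[F] IncidenceAlgebra F X) where
  carrier := {μ | ∃ (v : (IncidenceAlgebra F X)ˣ) (g : IncidenceAlgebra F X),
    (∀ x, g x x = 0) ∧ (v : IncidenceAlgebra F X) = 1 + g ∧ ∀ f, μ f = ↑v⁻¹ * f * ↑v}
  one_mem' := ⟨1, 0, fun _ => rfl, by simp, fun f => by simp⟩
  mul_mem' := by
    rintro μ ν ⟨v, g, hg, hvg, hv⟩ ⟨w, k, hk, hwk, hw⟩
    refine ⟨w * v, k + g + k * g, fun x => ?_, ?_, fun f => by simp [hv, hw, mul_assoc]⟩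
    · simp [IncidenceAlgebra.add_apply, hg, hk]
    · rw [Units.val_mul, hvg, hwk]
      noncomm_ring
  inv_mem' := by
    rintro μ ⟨v, g, hg, hvg, hv⟩
    have hinv : μ⁻¹ ∈ innerAut F (IncidenceAlgebra F X) := inv_mem ⟨v, hv⟩
    refine ⟨v⁻¹, ↑v⁻¹ - 1, fun x => ?_, by abel, fun f => ?_⟩
    · have h := congrArg (fun f : IncidenceAlgebra F X => f x x) v.inv_mul
      simp only [hvg] at h
      simpa [IncidenceAlgebra.sub_apply, IncidenceAlgebra.add_apply, hg, sub_eq_zero] using h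
    · apply μ.injective
      have h : μ (μ⁻¹ f) = f := by rw [← AlgEquiv.mul_apply, mul_inv_cancel, AlgEquiv.one_apply]
      rw [h, hv]
      simp [mul_assoc]

/-- `In₁(Aut C) = Θ⁻¹(In₁(Aut A))`. -/
def innerCoalgAutOne : Subgroup (IncidenceCoalgebra F X ≃ₗc[F] IncidenceCoalgebra F X) :=
  (innerAutOne F X).op.comap (Theta F X)

variable {F X}

/-- A multiplicative system: nonzero `d x y ∈ F` for `x < y` with `d x y = d x z * d z y` whenever
`x < z < y` (the values `d x y` with `x < y` false are irrelevant). -/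
structure IsMultSystem (d : X → X → F) : Prop where
  ne_zero : ∀ x y, x < y → d x y ≠ 0
  mul : ∀ x z y, x < z → z < y → d x y = d x z * d z y

variable (F X)

/-- `Mult C`: the group of automorphisms `[x,x] ↦ [x,x]`, `[x,y] ↦ d x y • [x,y]` (`x < y`) of
`C = Co(X,F)` for multiplicative systems `d`. -/
def multAut : Subgroup (IncidenceCoalgebra F X ≃ₗc[F] IncidenceCoalgebra F X) where
  carrier := {φ | ∃ d : X → X → F, IsMultSystem d ∧ (∀ x, φ (interval F x x) = interval F x x) ∧
    ∀ x y, x < y → φ (interval F x y) = d x y • interval F x y}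
  one_mem' := ⟨fun _ _ => 1, ⟨by simp, by simp⟩, fun _ => rfl, fun _ _ _ => (one_smul F _).symm⟩
  mul_mem' := by
    rintro φ ψ ⟨d, hd, h1, h2⟩ ⟨e, he, h3, h4⟩
    refine ⟨fun x y => d x y * e x y,
      ⟨fun x y h => mul_ne_zero (hd.1 x y h) (he.1 x y h), fun x z y h h' => ?_⟩,
      fun x => ?_, fun x y h => ?_⟩
    · simp only [hd.2 x z y h h', he.2 x z y h h']
      ring
    · change φ (ψ _) = _
      rw [h3, h1]
    · change φ (ψ _) = _
      rw [h4 x y h, map_smul, h2 x y h, smul_smul, mul_comm]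
  inv_mem' := by
    rintro φ ⟨d, hd, h1, h2⟩
    refine ⟨fun x y => (d x y)⁻¹,
      ⟨fun x y h => inv_ne_zero (hd.1 x y h), fun x z y h h' => ?_⟩, fun x => ?_, fun x y h => ?_⟩
    · simp only [hd.2 x z y h h', mul_inv]
    · change φ.symm _ = _
      conv_lhs => rw [← h1 x]
      exact φ.symm_apply_apply _
    · change φ.symm _ = _
      apply (EquivLike.injective φ)
      rw [CoalgEquiv.apply_symm_apply, map_smul, h2 x y h, smul_smul,
        inv_mul_cancel₀ (hd.1 x y h), one_smul]

/-- `Aut_C X`: the group of automorphisms `[x,y] ↦ [τ(x),τ(y)]` of `C = Co(X,F)` for automorphisms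
`τ` of the partially ordered set `X`. -/
def orderAut : Subgroup (IncidenceCoalgebra F X ≃ₗc[F] IncidenceCoalgebra F X) where
  carrier := {φ | ∃ τ : X ≃o X, ∀ x y, x ≤ y → φ (interval F x y) = interval F (τ x) (τ y)}
  one_mem' := ⟨OrderIso.refl X, fun _ _ _ => rfl⟩
  mul_mem' := by
    rintro φ ψ ⟨σ, hσ⟩ ⟨τ, hτ⟩
    refine ⟨τ.trans σ, fun x y h => ?_⟩
    change φ (ψ _) = _
    rw [hτ x y h, hσ _ _ (τ.monotone h)]
    rfl
  inv_mem' := by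
    rintro φ ⟨σ, hσ⟩
    refine ⟨σ.symm, fun x y h => ?_⟩
    change φ.symm _ = _
    apply (EquivLike.injective φ)
    rw [CoalgEquiv.apply_symm_apply, hσ _ _ (σ.symm.monotone h)]
    simp

end Coalg

end IncidenceCoalgebra

end

/-!
Every automorphism `φ` of `A = I(X,F)` is monomial up to conjugation by a unitriangular element.
The compression `e_x A e_x` by the diagonal idempotent of a point `x` is `F e_x`, so `φ(e_x)` is a
primitive idempotent; since an idempotent with zero diagonal vanishes (elements with zero diagonal
are locally nilpotent), the diagonal of `φ(e_x)` is the indicator of a single point `τ x`. The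
element `v = ∑ e_{τ x} φ(e_x)` has diagonal `1`, hence is invertible, and
`v φ(e_x) v⁻¹ = e_{τ x}`. Therefore `f ↦ v φ(f) v⁻¹` carries `e_x A e_y` to `e_{τ x} A e_{τ y}`,
which forces `τ` to be an order automorphism and `f ↦ v φ(f) v⁻¹` to permute the intervals up to
scalars (`IncidenceAlgebra.exists_unit_conj_apply_eq_mul`).

Conjugations and monomial maps are both transposes of linear maps of `C = Co(X,F)`, so every
automorphism of `A` is one. A multiplicative transpose comes from a coalgebra map because product
functionals separate the points of `C ⊗ C` (`exists_dualAlgEquiv_eq`); this makes `Θ` surjective,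
and injectivity is immediate.

Transported through `Θ`, the normal form reads `Aut C = In₁(Aut C) · Mult C · Aut_C X`. The
semidirect decompositions follow formally (`IsInternalSemidirect.of_three_factors`) once
`In(Aut C) · Mult C` is recognized as the normal subgroup `IncidenceCoalgebra.diagFixing` of those
`φ` for which `Θ(φ)` fixes all diagonals: it meets `Aut_C X` trivially, and a unitriangular element
whose conjugation is multiplicative commutes with every `e_x`, hence is `1`.
-/

/-! ### Internal semidirect products -/

section Group

variable {G : Type*} [Group G]

theorem IsInternalSemidirect.of_exists_mul {K N H : Subgroup G} (hN : N ≤ K) (hH : H ≤ K)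
    (hKN : ∀ k ∈ K, ∀ n ∈ N, k * n * k⁻¹ ∈ N) (hNH : ∀ g ∈ N, g ∈ H → g = 1)
    (hmul : ∀ k ∈ K, ∃ n ∈ N, ∃ h ∈ H, n * h = k) : IsInternalSemidirect K N H where
  left_le := hN
  right_le := hH
  normal := ⟨fun n hn k => hKN k k.2 n hn⟩
  isComplement := by
    refine Subgroup.isComplement'_of_disjoint_and_mul_eq_univ ?_ ?_
    · rw [Subgroup.disjoint_def]
      exact fun hx hx' => Subtype.ext (hNH _ hx hx')
    · refine Set.eq_univ_of_forall fun k => ?_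
      obtain ⟨n, hn, h, hh, hk⟩ := hmul k k.2
      exact ⟨⟨n, hN hn⟩, hn, ⟨h, hH hh⟩, hh, Subtype.ext hk⟩

/-- A factorization `G = N M H` in which `N` and `N M = P` are normal, `H` normalizes `M`, and
`N ∩ M = P ∩ H = 1`, makes `G` an iterated semidirect product with either bracketing. -/
theorem IsInternalSemidirect.of_three_factors {P N M H : Subgroup G} (hNP : N ≤ P) (hMP : M ≤ P)
    (hN : N.Normal) (hP : P.Normal) (hHM : ∀ h ∈ H, ∀ m ∈ M, h * m * h⁻¹ ∈ M)
    (hNM : ∀ g ∈ N, g ∈ M → g = 1) (hPH : ∀ g ∈ P, g ∈ H → g = 1)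
    (hmul : ∀ g : G, ∃ n ∈ N, ∃ m ∈ M, ∃ h ∈ H, n * (m * h) = g) :
    (∀ p ∈ P, ∃ n ∈ N, ∃ m ∈ M, n * m = p) ∧ IsInternalSemidirect ⊤ P H ∧
      IsInternalSemidirect P N M ∧ IsInternalSemidirect ⊤ N (M ⊔ H) ∧
      IsInternalSemidirect (M ⊔ H) M H := by
  have hPNM : ∀ p ∈ P, ∃ n ∈ N, ∃ m ∈ M, n * m = p := by
    intro p hp
    obtain ⟨n, hn, m, hm, h, hh, rfl⟩ := hmul p
    have h1 : h = 1 := by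
      refine hPH h ?_ hh
      rwa [← P.mul_mem_cancel_left (hMP hm), ← P.mul_mem_cancel_left (hNP hn)]
    exact ⟨n, hn, m, hm, by rw [h1, mul_one]⟩
  have hle : H ≤ Subgroup.normalizer (M : Set G) := Subgroup.le_normalizer_iff.2 hHM
  have hMH : ∀ q ∈ M ⊔ H, ∃ m ∈ M, ∃ h ∈ H, m * h = q := by
    intro q hq
    rw [← SetLike.mem_coe, Subgroup.coe_mul_of_right_le_normalizer_left _ _ hle] at hq
    exact hq
  refine ⟨hPNM, .of_exists_mul le_top le_top (fun k _ n hn => hP.conj_mem n hn k) hPH ?_,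
    .of_exists_mul hNP hMP (fun k _ n hn => hN.conj_mem n hn k) hNM hPNM,
    .of_exists_mul le_top le_top (fun k _ n hn => hN.conj_mem n hn k) ?_ ?_,
    .of_exists_mul le_sup_left le_sup_right ?_ (fun g hg hg' => hPH g (hMP hg) hg') hMH⟩
  · intro g _
    obtain ⟨n, hn, m, hm, h, hh, rfl⟩ := hmul g
    exact ⟨n * m, P.mul_mem (hNP hn) (hMP hm), h, hh, mul_assoc _ _ _⟩
  · intro g hgN hgQ
    obtain ⟨m, hm, h, hh, rfl⟩ := hMH g hgQ
    have h1 : h = 1 := hPH h (by rw [← P.mul_mem_cancel_left (hMP hm)]; exact hNP hgN) hh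
    rw [h1, mul_one] at hgN ⊢
    exact hNM m hgN hm
  · intro g _
    obtain ⟨n, hn, m, hm, h, hh, rfl⟩ := hmul g
    exact ⟨n, hn, m * h, Subgroup.mul_mem_sup hm hh, rfl⟩
  · exact Subgroup.le_normalizer_iff.1 (sup_le Subgroup.le_normalizer hle)

end Group

/-! ### Continuous automorphisms of the dual algebra of a coalgebra -/

section DualAlgebra

variable {F C : Type*} [Field F] [AddCommGroup C] [Module F C] [Coalgebra F C]

/-- A map `T : C^* → C^*` is a transpose if it is `χ ↦ χ ∘ S` for some linear `S : C → C`;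
for linear `T` this means continuity in the finite topology of `C^*`. -/
def IsTranspose (T : DualAlg F C → DualAlg F C) : Prop :=
  ∃ S : C →ₗ[F] C, ∀ χ c, T χ c = χ (S c)

theorem IsTranspose.comp {T U : DualAlg F C → DualAlg F C} (hT : IsTranspose T)
    (hU : IsTranspose U) : IsTranspose fun χ => T (U χ) := by
  obtain ⟨S, hS⟩ := hT
  obtain ⟨R, hR⟩ := hU
  exact ⟨R ∘ₗ S, fun χ c => by rw [hS, hR]; rfl⟩

/-- Left multiplication by `v` is the transpose of `c ↦ ∑ v(aᵢ) bᵢ`, where `Δ(c) = ∑ aᵢ ⊗ bᵢ`. -/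
theorem isTranspose_mul_left (v : DualAlg F C) : IsTranspose fun χ => v * χ := by
  refine ⟨(TensorProduct.lid F C).toLinearMap ∘ₗ LinearMap.rTensor C v.ofConv ∘ₗ
    CoalgebraStruct.comul, fun χ c => ?_⟩
  rw [LinearMap.convMul_apply]
  have : LinearMap.mul' F F ∘ₗ TensorProduct.map v.ofConv χ.ofConv =
      χ.ofConv ∘ₗ (TensorProduct.lid F C).toLinearMap ∘ₗ LinearMap.rTensor C v.ofConv := by
    ext a b; simp
  exact congrArg (fun l : C ⊗[F] C →ₗ[F] F => l (CoalgebraStruct.comul c)) this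

/-- Right multiplication by `v` is the transpose of `c ↦ ∑ v(bᵢ) aᵢ`, where `Δ(c) = ∑ aᵢ ⊗ bᵢ`. -/
theorem isTranspose_mul_right (v : DualAlg F C) : IsTranspose fun χ => χ * v := by
  refine ⟨(TensorProduct.rid F C).toLinearMap ∘ₗ LinearMap.lTensor C v.ofConv ∘ₗ
    CoalgebraStruct.comul, fun χ c => ?_⟩
  rw [LinearMap.convMul_apply]
  have : LinearMap.mul' F F ∘ₗ TensorProduct.map χ.ofConv v.ofConv =
      χ.ofConv ∘ₗ (TensorProduct.rid F C).toLinearMap ∘ₗ LinearMap.lTensor C v.ofConv := by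
    ext a b; simp [mul_comm]
  exact congrArg (fun l : C ⊗[F] C →ₗ[F] F => l (CoalgebraStruct.comul c)) this

theorem DualAlg.eq_of_forall_apply_eq {c d : C} (h : ∀ χ : DualAlg F C, χ c = χ d) : c = d := by
  rw [← sub_eq_zero, ← Module.forall_dual_apply_eq_zero_iff F]
  intro χ
  rw [map_sub, sub_eq_zero]
  exact h (WithConv.toConv χ)

theorem DualAlg.eq_of_forall_map_eq {s t : C ⊗[F] C}
    (h : ∀ χ ξ : DualAlg F C, LinearMap.mul' F F (TensorProduct.map χ.ofConv ξ.ofConv s) =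
      LinearMap.mul' F F (TensorProduct.map χ.ofConv ξ.ofConv t)) : s = t := by
  let b := Module.Basis.ofVectorSpace F C
  refine (b.tensorProduct b).ext_elem fun ⟨i, j⟩ => ?_
  have key : (b.tensorProduct b).coord (i, j) =
      LinearMap.mul' F F ∘ₗ TensorProduct.map (b.coord i) (b.coord j) := by
    ext x y
    simp [mul_comm]
  have := h (WithConv.toConv (b.coord i)) (WithConv.toConv (b.coord j))
  have h1 := LinearMap.congr_fun key s
  have h2 := LinearMap.congr_fun key t
  rw [Module.Basis.coord_apply] at h1 h2
  rw [h1, h2]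
  exact this

/-- An automorphism of `C^*` which, together with its inverse, is a transpose is `φ^*` for a
coalgebra automorphism `φ`: multiplicativity dualizes to compatibility with `Δ` since functionals
`χ ⊗ ξ` separate the points of `C ⊗ C`. -/
theorem exists_dualAlgEquiv_eq (T : DualAlg F C ≃ₐ[F] DualAlg F C) (hT : IsTranspose T)
    (hT' : IsTranspose T.symm) : ∃ φ : C ≃ₗc[F] C, dualAlgEquiv φ = T := by
  obtain ⟨S, hS⟩ := hT
  obtain ⟨R, hR⟩ := hT'
  have hSR : S ∘ₗ R = LinearMap.id := LinearMap.ext fun c =>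
    DualAlg.eq_of_forall_apply_eq fun χ => by
      rw [LinearMap.comp_apply, ← hS, ← hR, AlgEquiv.symm_apply_apply]; rfl
  have hRS : R ∘ₗ S = LinearMap.id := LinearMap.ext fun c =>
    DualAlg.eq_of_forall_apply_eq fun χ => by
      rw [LinearMap.comp_apply, ← hR, ← hS, AlgEquiv.apply_symm_apply]; rfl
  refine ⟨{ (LinearEquiv.ofLinearMap S R hSR hRS : C ≃ₗ[F] C) with
    counit_comp := ?_
    map_comp_comul := ?_ }, ?_⟩
  · refine LinearMap.ext fun c => ?_
    have h1 := hS 1 c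
    rw [map_one] at h1
    simpa [LinearMap.convOne_apply] using h1.symm
  · refine LinearMap.ext fun c => ?_
    refine DualAlg.eq_of_forall_map_eq fun χ ξ => ?_
    have h1 := hS (χ * ξ) c
    rw [map_mul, LinearMap.convMul_apply, LinearMap.convMul_apply] at h1
    refine Eq.trans ?_ h1
    have h2 : ∀ χ : DualAlg F C, (T χ).ofConv = χ.ofConv ∘ₗ S := fun χ => LinearMap.ext (hS χ)
    rw [h2, h2, TensorProduct.map_comp]
    rfl
  · ext χ c
    exact (hS χ c).symm

end DualAlgebra

/-! ### Unitriangular elements and idempotents of the incidence algebra -/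

namespace IncidenceAlgebra

section Idempotents

variable {F X : Type*} [Field F] [PartialOrder X] [DecidableEq X]

/-- The matrix unit of the interval `[a,b]`: the function with value `1` at `(a,b)` and `0`
elsewhere. -/
def single {a b : X} (h : a ≤ b) : IncidenceAlgebra F X :=
  ⟨fun x y => if x = a ∧ y = b then 1 else 0, fun x y hxy => if_neg (by
    rintro ⟨rfl, rfl⟩; exact hxy h)⟩

theorem single_apply {a b : X} (h : a ≤ b) (x y : X) :
    (single h : IncidenceAlgebra F X) x y = if x = a ∧ y = b then 1 else 0 := rfl

/-- The diagonal idempotent of a point `x`. -/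
def idem (x : X) : IncidenceAlgebra F X := single (le_refl x)

theorem idem_apply (x y z : X) :
    (idem x : IncidenceAlgebra F X) y z = if y = x ∧ z = x then 1 else 0 := rfl

theorem idem_apply_self (x y : X) :
    (idem x : IncidenceAlgebra F X) y y = if y = x then 1 else 0 := by
  simp [idem_apply]

end Idempotents

section Basic

variable {F X : Type*} [Field F] [PartialOrder X] [LocallyFiniteOrder X]

theorem mul_apply_self (f g : IncidenceAlgebra F X) (x : X) : (f * g) x x = f x x * g x x := by
  simp

variable [DecidableEq X]

theorem pow_apply_eq_zero {g : IncidenceAlgebra F X} (hg : ∀ x, g x x = 0) (n : ℕ) {x y : X}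
    (hn : (Finset.Icc x y).card ≤ n) : (g ^ n) x y = 0 := by
  induction n generalizing x with
  | zero =>
    have : ¬ x ≤ y := by
      rw [← Finset.nonempty_Icc, Finset.not_nonempty_iff_eq_empty]
      exact Finset.card_eq_zero.1 (Nat.le_zero.1 hn)
    exact apply_eq_zero_of_not_le this _
  | succ n ih =>
    rw [pow_succ', mul_apply]
    refine Finset.sum_eq_zero fun z hz => ?_
    obtain ⟨hxz, hzy⟩ := Finset.mem_Icc.1 hz
    obtain rfl | hne := eq_or_lt_of_le hxz
    · rw [hg, zero_mul]
    · rw [ih, mul_zero]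
      have := Finset.card_lt_card (Finset.Icc_ssubset_Icc_left (hxz.trans hzy) hne le_rfl)
      omega

/-- An element with zero diagonal is locally nilpotent, so a unitriangular element `1 - g` is
inverted by the geometric series `∑ gⁿ`, which is a finite sum at each interval. -/
theorem isUnit_of_apply_self_eq_one {v : IncidenceAlgebra F X} (hv : ∀ x, v x x = 1) :
    IsUnit v := by
  set g := 1 - v with hgdef
  have hg : ∀ x, g x x = 0 := fun x => by simp [hgdef, sub_apply, hv]
  have hvg : v = 1 - g := by simp [hgdef]
  let s : ℕ → IncidenceAlgebra F X := fun n => ∑ i ∈ Finset.range n, g ^ i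
  have hs : ∀ {x y : X} (n : ℕ), (Finset.Icc x y).card ≤ n →
      s n x y = s (Finset.Icc x y).card x y := by
    intro x y n hn
    induction n, hn using Nat.le_induction with
    | base => rfl
    | succ n hn ih =>
      rw [← ih]
      simp only [s, Finset.sum_range_succ, add_apply, pow_apply_eq_zero hg n hn, add_zero]
  let h : IncidenceAlgebra F X := ⟨fun x y => s (Finset.Icc x y).card x y,
    fun x y hxy => apply_eq_zero_of_not_le hxy _⟩
  have hh : ∀ {x y : X} (n : ℕ), (Finset.Icc x y).card ≤ n → h x y = s n x y :=
    fun n hn => (hs n hn).symm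
  have h1 : v * h = 1 := by
    ext x y hxy
    set n := (Finset.Icc x y).card with hn
    have : (v * h) x y = (v * s n) x y := by
      rw [mul_apply, mul_apply]
      refine Finset.sum_congr rfl fun z hz => ?_
      rw [hh n (Finset.card_le_card
        (Finset.Icc_subset_Icc_left (Finset.mem_Icc.1 hz).1))]
    rw [this, hvg, mul_neg_geom_sum, sub_apply, pow_apply_eq_zero hg n hn.ge, sub_zero]
  have h2 : h * v = 1 := by
    ext x y hxy
    set n := (Finset.Icc x y).card with hn
    have : (h * v) x y = (s n * v) x y := by
      rw [mul_apply, mul_apply]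
      refine Finset.sum_congr rfl fun z hz => ?_
      rw [hh n (Finset.card_le_card
        (Finset.Icc_subset_Icc_right (Finset.mem_Icc.1 hz).2))]
    rw [this, hvg, geom_sum_mul_neg, sub_apply, pow_apply_eq_zero hg n hn.ge, sub_zero]
  exact ⟨⟨v, h, h1, h2⟩, rfl⟩

theorem idem_mul_apply (x : X) (f : IncidenceAlgebra F X) (y z : X) :
    (idem x * f : IncidenceAlgebra F X) y z = if y = x then f y z else 0 := by
  rw [mul_apply]
  by_cases hyz : y ≤ z
  · rw [Finset.sum_eq_single_of_mem y (Finset.left_mem_Icc.2 hyz)]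
    · simp [idem_apply]
    · intro w _ hw
      rw [idem_apply, if_neg, zero_mul]
      rintro ⟨rfl, rfl⟩
      exact hw rfl
  · simp [Finset.Icc_eq_empty hyz, apply_eq_zero_of_not_le hyz]

theorem mul_idem_apply (x : X) (f : IncidenceAlgebra F X) (y z : X) :
    (f * idem x : IncidenceAlgebra F X) y z = if z = x then f y z else 0 := by
  rw [mul_apply]
  by_cases hyz : y ≤ z
  · rw [Finset.sum_eq_single_of_mem z (Finset.right_mem_Icc.2 hyz)]
    · simp [idem_apply]
    · intro w _ hw
      rw [idem_apply, if_neg, mul_zero]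
      rintro ⟨rfl, rfl⟩
      exact hw rfl
  · simp [Finset.Icc_eq_empty hyz, apply_eq_zero_of_not_le hyz]

theorem idem_mul_mul_idem {x y : X} (h : x ≤ y) (f : IncidenceAlgebra F X) :
    idem x * f * idem y = f x y • single h := by
  ext u w _
  rw [mul_idem_apply, idem_mul_apply, constSMul_apply, single_apply]
  by_cases hu : u = x <;> by_cases hw : w = y <;> simp [hu, hw]

theorem single_mul_single {x z y : X} (h : x ≤ z) (h' : z ≤ y) :
    (single h * single h' : IncidenceAlgebra F X) = single (h.trans h') := by
  ext u w huw
  rw [mul_apply, single_apply]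
  by_cases hu : u = x ∧ w = y
  · obtain ⟨rfl, rfl⟩ := hu
    rw [Finset.sum_eq_single_of_mem z (Finset.mem_Icc.2 ⟨h, h'⟩)]
    · simp [single_apply]
    · intro t _ ht
      simp [single_apply, ht]
  · rw [if_neg hu]
    refine Finset.sum_eq_zero fun t _ => ?_
    simp only [single_apply]
    by_cases h1 : u = x <;> simp_all

theorem idem_mul_idem (x : X) : (idem x * idem x : IncidenceAlgebra F X) = idem x :=
  single_mul_single _ _

theorem idem_mul_idem_of_ne {x y : X} (h : x ≠ y) :
    (idem x * idem y : IncidenceAlgebra F X) = 0 := by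
  ext u w _
  rw [idem_mul_apply, idem_apply]
  by_cases hu : u = x <;> simp_all

theorem idem_mul_mul_idem_self (x : X) (f : IncidenceAlgebra F X) :
    idem x * f * idem x = f x x • idem x :=
  idem_mul_mul_idem le_rfl f

/-- An idempotent with zero diagonal is zero, being locally nilpotent. -/
theorem eq_zero_of_isIdempotentElem {p : IncidenceAlgebra F X} (hp : IsIdempotentElem p)
    (h : ∀ x, p x x = 0) : p = 0 := by
  ext x y hxy
  have hcard : (Finset.Icc x y).card ≠ 0 := by
    rw [Finset.card_ne_zero, Finset.nonempty_Icc]; exact hxy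
  rw [← hp.pow_eq hcard, pow_apply_eq_zero h _ le_rfl]
  rfl

end Basic

/-! ### Automorphisms of the incidence algebra -/

section Aut

variable {F X : Type*} [Field F] [PartialOrder X] [LocallyFiniteOrder X] [DecidableEq X]

/-- Since `e_x A e_x = F e_x`, the image `φ(e_x)` is a primitive idempotent, and its diagonal, a
nonzero `0`-`1` function, is supported at a single point. -/
theorem exists_apply_idem_apply_self (φ : IncidenceAlgebra F X ≃ₐ[F] IncidenceAlgebra F X) (x : X) :
    ∃ y, ∀ z, φ (idem x) z z = if z = y then 1 else 0 := by
  have hp : φ (idem x) * φ (idem x) = φ (idem x) := by rw [← map_mul, idem_mul_idem]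
  have hne : ∃ y, φ (idem x) y y ≠ 0 := by
    by_contra! h
    have h0 : φ (idem x) = 0 := eq_zero_of_isIdempotentElem hp h
    have h1 := congrArg (fun f : IncidenceAlgebra F X => f x x) ((map_eq_zero_iff φ φ.injective).1 h0)
    simp [idem_apply] at h1
  obtain ⟨y, hy⟩ := hne
  have h01 : ∀ z, φ (idem x) z z * φ (idem x) z z = φ (idem x) z z := fun z => by
    rw [← mul_apply_self, hp]
  have hy1 : φ (idem x) y y = 1 := mul_left_cancel₀ hy (by rw [h01, mul_one])
  refine ⟨y, fun z => ?_⟩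
  split_ifs with hz
  · rw [hz, hy1]
  · -- compress the idempotent `e_y` by `φ(e_x)`: the result is a multiple of `φ(e_x)`
    have h1 := congrArg φ (idem_mul_mul_idem_self x (φ.symm (idem y)))
    rw [map_mul, map_mul, map_smul, AlgEquiv.apply_symm_apply] at h1
    have h2 : ∀ w, φ (idem x) w w * idem y w w * φ (idem x) w w =
        φ.symm (idem y) x x * φ (idem x) w w := fun w => by
      rw [← mul_apply_self, ← mul_apply_self, h1]; rfl
    have h3 := h2 y
    have h4 := h2 z
    rw [hy1, idem_apply_self, if_pos rfl, mul_one, mul_one, mul_one] at h3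
    rw [← h3, idem_apply_self, if_neg hz, one_mul, mul_zero, zero_mul] at h4
    exact h4.symm

/-- An automorphism `φ` permutes the diagonal idempotents modulo the ideal of elements with zero
diagonal. -/
theorem exists_perm_apply_idem (φ : IncidenceAlgebra F X ≃ₐ[F] IncidenceAlgebra F X) :
    ∃ τ : X ≃ X, ∀ x z, φ (idem x) z z = if z = τ x then 1 else 0 := by
  choose t ht using fun φ : IncidenceAlgebra F X ≃ₐ[F] IncidenceAlgebra F X =>
    exists_apply_idem_apply_self φ
  have key : ∀ (φ : IncidenceAlgebra F X ≃ₐ[F] IncidenceAlgebra F X) (y : X),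
      t φ (t φ.symm y) = y := by
    intro φ y
    have h1 := congrArg φ (idem_mul_mul_idem_self (t φ.symm y) (φ.symm (idem y)))
    rw [ht, if_pos rfl, one_smul, map_mul, map_mul, AlgEquiv.apply_symm_apply] at h1
    have h2 := congrArg (fun f : IncidenceAlgebra F X =>
      f (t φ (t φ.symm y)) (t φ (t φ.symm y))) h1
    simp only [mul_apply_self, ht, if_true, one_mul, mul_one, idem_apply_self] at h2
    by_contra hne
    simp [hne] at h2
  exact ⟨⟨t φ, t φ.symm, fun x => key φ.symm x, key φ⟩, ht φ⟩

theorem apply_apply_perm {φ : IncidenceAlgebra F X ≃ₐ[F] IncidenceAlgebra F X} {τ : X ≃ X}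
    (hτ : ∀ x z, φ (idem x) z z = if z = τ x then 1 else 0) (f : IncidenceAlgebra F X) (x : X) :
    φ f (τ x) (τ x) = f x x := by
  have h1 := congrArg (fun g => φ g (τ x) (τ x)) (idem_mul_mul_idem_self x f)
  simp only [map_mul, map_smul, mul_apply_self, hτ, constSMul_apply] at h1
  simpa using h1

/-- The unitriangular element `∑ e_{τ x} φ(e_x)` intertwines the idempotents `φ(e_x)` and
`e_{τ x}`. -/
theorem exists_unit_mul_apply_idem (φ : IncidenceAlgebra F X ≃ₐ[F] IncidenceAlgebra F X) :
    ∃ (τ : X ≃ X) (v : (IncidenceAlgebra F X)ˣ), (∀ x, (v : IncidenceAlgebra F X) x x = 1) ∧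
      ∀ x, (v : IncidenceAlgebra F X) * φ (idem x) * ↑v⁻¹ = (idem (τ x) : IncidenceAlgebra F X) := by
  obtain ⟨τ, hτ⟩ := exists_perm_apply_idem φ
  let v : IncidenceAlgebra F X := ⟨fun y z => φ (idem (τ.symm y)) y z,
    fun y z h => apply_eq_zero_of_not_le h _⟩
  have hv : ∀ y z, v y z = φ (idem (τ.symm y)) y z := fun _ _ => rfl
  have hv1 : ∀ x, v x x = 1 := fun x => by rw [hv, hτ]; simp
  obtain ⟨u, hu⟩ := isUnit_of_apply_self_eq_one hv1
  refine ⟨τ, u, fun x => by rw [hu, hv1], fun x => ?_⟩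
  rw [Units.mul_inv_eq_iff_eq_mul, hu]
  ext y z _
  have h1 : (v * φ (idem x)) y z = φ (idem (τ.symm y) * idem x) y z := by
    rw [map_mul, mul_apply, mul_apply]
    rfl
  rw [h1, idem_mul_apply]
  split_ifs with hy
  · rw [hv, hy, Equiv.symm_apply_apply, idem_mul_idem]
  · rw [idem_mul_idem_of_ne (fun h => hy (by rw [← h, Equiv.apply_symm_apply])), map_zero]
    rfl

/-- An automorphism that permutes the diagonal idempotents is monomial: it permutes the intervals
up to scalars. -/
theorem exists_apply_eq_mul {ψ : IncidenceAlgebra F X ≃ₐ[F] IncidenceAlgebra F X} {τ : X ≃ X}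
    (hτ : ∀ x, ψ (idem x) = idem (τ x)) : ∃ c : X → X → F, ∀ f u w,
      ψ f (τ u) (τ w) = c u w * f u w := by
  classical
  -- for `u ≰ w` the compression `e_u f e_w` vanishes, hence the value `0`
  refine ⟨fun u w => if h : u ≤ w then ψ (single h) (τ u) (τ w) else 0, fun f u w => ?_⟩
  have h1 : ψ (idem u * f * idem w) (τ u) (τ w) = ψ f (τ u) (τ w) := by
    rw [map_mul, map_mul, hτ, hτ, mul_idem_apply, if_pos rfl, idem_mul_apply, if_pos rfl]
  beta_reduce
  split_ifs with h
  · rw [← h1, idem_mul_mul_idem h, map_smul, constSMul_apply, smul_eq_mul, mul_comm]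
  · rw [← h1, zero_mul]
    have : idem u * f * idem w = 0 := by
      ext a b hab
      rw [mul_idem_apply, idem_mul_apply]
      split_ifs with hb ha
      · exact apply_eq_zero_of_not_le (by rwa [ha, hb]) _
      · rfl
      · rfl
    rw [this, map_zero]
    rfl

/-- Surjectivity of `ψ` forces `τ⁻¹` to be monotone and the scalars to be nonzero. -/
theorem le_and_ne_zero_of_apply_eq_mul {ψ : IncidenceAlgebra F X ≃ₐ[F] IncidenceAlgebra F X}
    {τ : X ≃ X} {c : X → X → F} (hc : ∀ f u w, ψ f (τ u) (τ w) = c u w * f u w) {u w : X}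
    (h : τ u ≤ τ w) : u ≤ w ∧ c u w ≠ 0 := by
  have h1 := hc (ψ.symm (single h)) u w
  rw [AlgEquiv.apply_symm_apply, single_apply, if_pos ⟨rfl, rfl⟩] at h1
  refine ⟨?_, left_ne_zero_of_mul (h1 ▸ one_ne_zero)⟩
  by_contra hn
  rw [apply_eq_zero_of_not_le hn, mul_zero] at h1
  exact one_ne_zero h1

/-- Every automorphism of `I(X,F)` is, up to conjugation by a unitriangular element, monomial over
an automorphism of the partially ordered set `X`. -/
theorem exists_unit_conj_apply_eq_mul (φ : IncidenceAlgebra F X ≃ₐ[F] IncidenceAlgebra F X) :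
    ∃ (v : (IncidenceAlgebra F X)ˣ) (σ : X ≃o X) (c : X → X → F),
      (∀ x, (v : IncidenceAlgebra F X) x x = 1) ∧ (∀ u w, u ≤ w → c u w ≠ 0) ∧
      ∀ f u w, (↑v * φ f * ↑v⁻¹ : IncidenceAlgebra F X) u w = c u w * f (σ u) (σ w) := by
  obtain ⟨τ, v, hv, hvτ⟩ := exists_unit_mul_apply_idem φ
  let ψ : IncidenceAlgebra F X ≃ₐ[F] IncidenceAlgebra F X :=
    φ.trans (MulSemiringAction.toAlgEquiv F (IncidenceAlgebra F X) (ConjAct.toConjAct v))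
  have hψ : ∀ f, ψ f = ↑v * φ f * ↑v⁻¹ := fun f => rfl
  have h1 : ∀ x, ψ (idem x) = idem (τ x) := hvτ
  have h2 : ∀ x, ψ.symm (idem x) = idem (τ.symm x) := fun x => by
    rw [AlgEquiv.symm_apply_eq, h1, Equiv.apply_symm_apply]
  obtain ⟨c, hc⟩ := exists_apply_eq_mul h1
  obtain ⟨c', hc'⟩ := exists_apply_eq_mul h2
  refine ⟨v, ⟨τ.symm, fun {a b} => ⟨fun h => ?_, fun h => ?_⟩⟩,
    fun u w => c (τ.symm u) (τ.symm w), hv, fun u w h => ?_, fun f u w => ?_⟩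
  · exact (le_and_ne_zero_of_apply_eq_mul hc' h).1
  · refine (le_and_ne_zero_of_apply_eq_mul hc ?_).1
    simpa using h
  · refine (le_and_ne_zero_of_apply_eq_mul hc ?_).2
    simpa using h
  · rw [← hψ]
    simpa using hc f (τ.symm u) (τ.symm w)

end Aut

end IncidenceAlgebra

/-! ### Automorphisms of the incidence coalgebra -/

namespace IncidenceCoalgebra

variable {F X : Type*} [Field F] [PartialOrder X] [LocallyFiniteOrder X] [DecidableEq X]

theorem dualEquiv_symm_apply_interval (f : IncidenceAlgebra F X) (x y : X) :
    (dualEquiv F X).symm f (interval F x y) = f x y :=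
  congrArg (fun g : IncidenceAlgebra F X => g x y) ((dualEquiv F X).apply_symm_apply f)

theorem ext_of_dualEquiv_symm {c d : IncidenceCoalgebra F X}
    (h : ∀ f, (dualEquiv F X).symm f c = (dualEquiv F X).symm f d) : c = d :=
  DualAlg.eq_of_forall_apply_eq (F := F) fun χ => by
    rw [← (dualEquiv F X).symm_apply_apply χ]; exact h _

theorem Theta_mul_apply (φ ψ : IncidenceCoalgebra F X ≃ₗc[F] IncidenceCoalgebra F X)
    (f : IncidenceAlgebra F X) :
    (Theta F X (φ * ψ)).unop f = (Theta F X ψ).unop ((Theta F X φ).unop f) := by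
  rw [map_mul]; rfl

theorem Theta_inv_apply (φ : IncidenceCoalgebra F X ≃ₗc[F] IncidenceCoalgebra F X)
    (f : IncidenceAlgebra F X) :
    (Theta F X φ).unop ((Theta F X φ⁻¹).unop f) = f := by
  rw [← Theta_mul_apply, inv_mul_cancel, map_one]; rfl

theorem Theta_apply_inv (φ : IncidenceCoalgebra F X ≃ₗc[F] IncidenceCoalgebra F X)
    (f : IncidenceAlgebra F X) :
    (Theta F X φ⁻¹).unop ((Theta F X φ).unop f) = f := by
  rw [← Theta_mul_apply, mul_inv_cancel, map_one]; rfl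

theorem apply_interval_of_Theta {φ : IncidenceCoalgebra F X ≃ₗc[F] IncidenceCoalgebra F X}
    {x y u w : X} {c : F} (h : ∀ f, (Theta F X φ).unop f x y = c * f u w) :
    φ (interval F x y) = c • interval F u w :=
  ext_of_dualEquiv_symm fun f => by
    rw [← Theta_apply, h, map_smul, dualEquiv_symm_apply_interval, smul_eq_mul]

theorem Theta_of_apply_interval {φ : IncidenceCoalgebra F X ≃ₗc[F] IncidenceCoalgebra F X}
    {x y u w : X} {c : F} (h : φ (interval F x y) = c • interval F u w)
    (f : IncidenceAlgebra F X) : (Theta F X φ).unop f x y = c * f u w := by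
  rw [Theta_apply, h, map_smul, dualEquiv_symm_apply_interval, smul_eq_mul]

theorem ext_interval {φ ψ : IncidenceCoalgebra F X ≃ₗc[F] IncidenceCoalgebra F X}
    (h : ∀ x y, x ≤ y → φ (interval F x y) = ψ (interval F x y)) : φ = ψ := by
  refine CoalgEquiv.ext fun c => ?_
  exact LinearMap.congr_fun (linearMap_ext
    (f := (φ : IncidenceCoalgebra F X →ₗc[F] IncidenceCoalgebra F X).toLinearMap)
    (g := (ψ : IncidenceCoalgebra F X →ₗc[F] IncidenceCoalgebra F X).toLinearMap) h) c

theorem Theta_injective : Function.Injective (Theta F X) := by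
  intro φ ψ h
  refine ext_interval fun x y _ => ext_of_dualEquiv_symm fun f => ?_
  rw [← Theta_apply, h, Theta_apply]

/-- Automorphisms of `I(X,F)` are automatically continuous: conjugations are, and so are monomial
automorphisms. -/
theorem isTranspose_autCongr (φ : IncidenceAlgebra F X ≃ₐ[F] IncidenceAlgebra F X) :
    IsTranspose fun χ => (dualEquiv F X).symm (φ (dualEquiv F X χ)) := by
  obtain ⟨v, σ, c, -, -, hc⟩ := IncidenceAlgebra.exists_unit_conj_apply_eq_mul φ
  have h1 : IsTranspose fun χ => (dualEquiv F X).symm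
      ((v : IncidenceAlgebra F X) * φ (dualEquiv F X χ) * ↑v⁻¹) := by
    refine ⟨(basis F X).constr F fun I => c I.fst I.snd • interval F (σ I.fst) (σ I.snd),
      fun χ a => ?_⟩
    refine LinearMap.congr_fun (g := χ.ofConv ∘ₗ (basis F X).constr F _)
      (linearMap_ext fun x y h => ?_) a
    rw [dualEquiv_symm_apply_interval, hc, LinearMap.comp_apply, interval_of_le F h,
      Module.Basis.constr_basis, map_smul, smul_eq_mul]
    rfl
  have h2 := (isTranspose_mul_right ((dualEquiv F X).symm ↑v)).comp
    ((isTranspose_mul_left ((dualEquiv F X).symm ↑v⁻¹)).comp h1)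
  convert h2 using 2 with χ
  rw [← map_mul, ← map_mul]
  simp [mul_assoc]

theorem Theta_surjective : Function.Surjective (Theta F X) := by
  intro φ
  let T := (AlgEquiv.autCongr (dualEquiv F X)).symm φ.unop
  obtain ⟨α, hα⟩ := exists_dualAlgEquiv_eq T (isTranspose_autCongr φ.unop)
    (isTranspose_autCongr φ.unop.symm)
  refine ⟨α, MulOpposite.unop_injective ?_⟩
  change AlgEquiv.autCongr (dualEquiv F X) (dualAlgEquiv α) = φ.unop
  rw [hα]
  exact (AlgEquiv.autCongr (dualEquiv F X)).apply_symm_apply _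

/-- A coalgebra automorphism that scales every interval is multiplicative. -/
theorem mem_multAut_of_apply_interval
    {φ : IncidenceCoalgebra F X ≃ₗc[F] IncidenceCoalgebra F X} {d : X → X → F}
    (hd : ∀ x y, x < y → d x y ≠ 0)
    (h : ∀ x y, x ≤ y → φ (interval F x y) = d x y • interval F x y) : φ ∈ multAut F X := by
  have hT := fun x y (hxy : x ≤ y) => Theta_of_apply_interval (h x y hxy)
  refine ⟨d, ⟨hd, fun x z y hxz hzy => ?_⟩, fun x => ?_, fun x y hxy => h x y hxy.le⟩
  · -- evaluate the images of the matrix units of `[x,z]` and `[z,y]` and of their product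
    have h1 := hT x y (hxz.trans hzy).le (IncidenceAlgebra.single (hxz.trans hzy).le)
    rw [← IncidenceAlgebra.single_mul_single hxz.le hzy.le, map_mul,
      IncidenceAlgebra.single_mul_single, IncidenceAlgebra.single_apply, if_pos ⟨rfl, rfl⟩,
      mul_one, IncidenceAlgebra.mul_apply,
      Finset.sum_eq_single_of_mem z (Finset.mem_Icc.2 ⟨hxz.le, hzy.le⟩)] at h1
    · rw [← h1, hT x z hxz.le, hT z y hzy.le, IncidenceAlgebra.single_apply,
        IncidenceAlgebra.single_apply, if_pos ⟨rfl, rfl⟩, if_pos ⟨rfl, rfl⟩, mul_one, mul_one]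
    · intro w hw hne
      rw [hT x w (Finset.mem_Icc.1 hw).1, IncidenceAlgebra.single_apply,
        if_neg fun h => hne h.2, mul_zero, zero_mul]
  · have h1 := hT x x le_rfl 1
    rw [map_one, IncidenceAlgebra.one_apply, if_pos rfl, mul_one] at h1
    rw [h x x le_rfl, ← h1, one_smul]

/-- The coalgebra automorphism `[x,y] ↦ [σ(x),σ(y)]` lies in `Aut_C X`. -/
theorem exists_mem_orderAut (σ : X ≃o X) :
    ∃ φ ∈ orderAut F X, ∀ x y, x ≤ y → φ (interval F x y) = interval F (σ x) (σ y) := by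
  let e : NonemptyInterval X ≃ NonemptyInterval X :=
    { toFun := fun I => I.map σ.toOrderEmbedding.toOrderHom
      invFun := fun I => I.map σ.symm.toOrderEmbedding.toOrderHom
      left_inv := fun I => by ext <;> simp
      right_inv := fun I => by ext <;> simp }
  let S : IncidenceCoalgebra F X ≃ₗ[F] IncidenceCoalgebra F X := (basis F X).equiv (basis F X) e
  have hS : ∀ {x y : X}, x ≤ y → S (interval F x y) = interval F (σ x) (σ y) := by
    intro x y h
    rw [interval_of_le F h, interval_of_le F (σ.monotone h)]
    exact Module.Basis.equiv_apply _ _ _ _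
  have hcounit : CoalgebraStruct.counit ∘ₗ S.toLinearMap = CoalgebraStruct.counit (R := F) := by
    refine linearMap_ext fun x y h => ?_
    rw [LinearMap.comp_apply, LinearEquiv.coe_coe, hS h, counit_interval F (σ.monotone h),
      counit_interval F h]
    simp
  have hcomul : TensorProduct.map S.toLinearMap S.toLinearMap ∘ₗ CoalgebraStruct.comul =
      CoalgebraStruct.comul (R := F) ∘ₗ S.toLinearMap := by
    refine linearMap_ext fun x y h => ?_
    rw [LinearMap.comp_apply, LinearMap.comp_apply, LinearEquiv.coe_coe, hS h,
      comul_interval F (σ.monotone h), comul_interval F h, map_sum]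
    refine Finset.sum_equiv σ.toEquiv (fun z => by simp) fun z hz => ?_
    obtain ⟨h1, h2⟩ := Finset.mem_Icc.1 hz
    rw [TensorProduct.map_tmul, LinearEquiv.coe_coe, hS h1, hS h2]
    rfl
  exact ⟨{ S with counit_comp := hcounit, map_comp_comul := hcomul }, ⟨σ, fun x y h => hS h⟩,
    fun x y h => hS h⟩

/-- The group of those `φ ∈ Aut C` for which `Θ(φ)` fixes the diagonal of every `f ∈ I(X,F)`. It
equals `In(Aut C) · Mult C`. -/
def diagFixing (F X : Type*) [Field F] [PartialOrder X] [LocallyFiniteOrder X] [DecidableEq X] :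
    Subgroup (IncidenceCoalgebra F X ≃ₗc[F] IncidenceCoalgebra F X) where
  carrier := {φ | ∀ f x, (Theta F X φ).unop f x x = f x x}
  one_mem' f x := by rw [map_one]; rfl
  mul_mem' {φ ψ} hφ hψ f x := by rw [Theta_mul_apply, hψ, hφ]
  inv_mem' {φ} hφ f x := by rw [← hφ ((Theta F X φ⁻¹).unop f) x, Theta_inv_apply]

/-- `Θ(φ)` permutes the diagonal entries. -/
theorem exists_Theta_apply_perm (φ : IncidenceCoalgebra F X ≃ₗc[F] IncidenceCoalgebra F X) :
    ∃ τ : X ≃ X, ∀ f x, (Theta F X φ).unop f (τ x) (τ x) = f x x := by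
  obtain ⟨τ, hτ⟩ := IncidenceAlgebra.exists_perm_apply_idem (Theta F X φ).unop
  exact ⟨τ, IncidenceAlgebra.apply_apply_perm hτ⟩

theorem diagFixing_normal : (diagFixing F X).Normal where
  conj_mem ν hν φ f x := by
    obtain ⟨τ, hτ⟩ := exists_Theta_apply_perm φ⁻¹
    obtain ⟨z, rfl⟩ := τ.surjective x
    rw [Theta_mul_apply, Theta_mul_apply, hτ, hν, ← hτ _ z, Theta_apply_inv]

theorem innerCoalgAut_apply {ν : IncidenceCoalgebra F X ≃ₗc[F] IncidenceCoalgebra F X}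
    (hν : ν ∈ innerCoalgAut F (IncidenceCoalgebra F X)) :
    ∃ v : (IncidenceAlgebra F X)ˣ, ∀ f, (Theta F X ν).unop f = ↑v⁻¹ * f * ↑v := by
  obtain ⟨v, hv⟩ := hν
  refine ⟨Units.map (dualEquiv F X : _ →* IncidenceAlgebra F X) v, fun f => ?_⟩
  change dualEquiv F X (dualAlgEquiv ν ((dualEquiv F X).symm f)) = _
  have : dualAlgEquiv ν ((dualEquiv F X).symm f) = ↑v⁻¹ * (dualEquiv F X).symm f * ↑v := hv _
  rw [this, map_mul, map_mul, AlgEquiv.apply_symm_apply]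
  rfl

theorem innerCoalgAut_le_diagFixing :
    innerCoalgAut F (IncidenceCoalgebra F X) ≤ diagFixing F X := by
  intro ν hν f x
  obtain ⟨v, hv⟩ := innerCoalgAut_apply hν
  have h1 := congrArg (fun g : IncidenceAlgebra F X => g x x) v.inv_mul
  simp only [IncidenceAlgebra.mul_apply_self, IncidenceAlgebra.one_apply, if_true] at h1
  rw [hv, IncidenceAlgebra.mul_apply_self, IncidenceAlgebra.mul_apply_self, mul_right_comm, h1,
    one_mul]

theorem innerCoalgAutOne_le_innerCoalgAut :
    innerCoalgAutOne F X ≤ innerCoalgAut F (IncidenceCoalgebra F X) := by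
  rintro ν ⟨v, g, -, -, hv⟩
  refine ⟨Units.map ((dualEquiv F X).symm : _ →* DualAlg F (IncidenceCoalgebra F X)) v,
    fun χ => (dualEquiv F X).injective ?_⟩
  have h1 := hv (dualEquiv F X χ)
  change dualEquiv F X (dualAlgEquiv ν ((dualEquiv F X).symm (dualEquiv F X χ))) = _ at h1
  rw [AlgEquiv.symm_apply_apply] at h1
  refine h1.trans ?_
  change _ = dualEquiv F X ((dualEquiv F X).symm _ * χ * (dualEquiv F X).symm _)
  rw [map_mul, map_mul, AlgEquiv.apply_symm_apply, AlgEquiv.apply_symm_apply]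
  rfl

theorem multAut_le_diagFixing : multAut F X ≤ diagFixing F X := by
  rintro φ ⟨d, -, h, -⟩ f x
  rw [Theta_apply, h, dualEquiv_symm_apply_interval]

theorem eq_one_of_mem_diagFixing_of_mem_orderAut
    {φ : IncidenceCoalgebra F X ≃ₗc[F] IncidenceCoalgebra F X} (h : φ ∈ diagFixing F X)
    (h' : φ ∈ orderAut F X) : φ = 1 := by
  obtain ⟨σ, hσ⟩ := h'
  have key : ∀ x, σ x = x := by
    intro x
    have h1 := h (IncidenceAlgebra.idem x) x
    rw [Theta_apply, hσ x x le_rfl, dualEquiv_symm_apply_interval,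
      IncidenceAlgebra.idem_apply_self, IncidenceAlgebra.idem_apply_self, if_pos rfl] at h1
    by_contra hne
    simp [hne] at h1
  refine ext_interval fun x y hxy => ?_
  rw [hσ x y hxy, key, key]
  rfl

theorem eq_one_of_mem_innerCoalgAutOne_of_mem_multAut
    {φ : IncidenceCoalgebra F X ≃ₗc[F] IncidenceCoalgebra F X} (h : φ ∈ innerCoalgAutOne F X)
    (h' : φ ∈ multAut F X) : φ = 1 := by
  obtain ⟨v, g, hg, hvg, hv⟩ := h
  obtain ⟨d, -, h1, h2⟩ := h'
  have hidem : ∀ x, (Theta F X φ).unop (IncidenceAlgebra.idem x) = IncidenceAlgebra.idem x := by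
    intro x
    ext y z hyz
    obtain rfl | hlt := eq_or_lt_of_le hyz
    · rw [Theta_apply, h1, dualEquiv_symm_apply_interval]
    · rw [Theta_of_apply_interval (h2 y z hlt), IncidenceAlgebra.idem_apply, if_neg, mul_zero]
      rintro ⟨rfl, rfl⟩
      exact hlt.ne rfl
  -- `v` commutes with all `e_x`, hence is diagonal
  have hcomm : ∀ x, (v : IncidenceAlgebra F X) * IncidenceAlgebra.idem x =
      IncidenceAlgebra.idem x * (v : IncidenceAlgebra F X) := by
    intro x
    have h3 : (Theta F X φ).unop (IncidenceAlgebra.idem x) = _ := hv (IncidenceAlgebra.idem x)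
    rwa [hidem, mul_assoc, Units.eq_inv_mul_iff_mul_eq] at h3
  have hv1 : (v : IncidenceAlgebra F X) = 1 := by
    ext y z hyz
    rw [IncidenceAlgebra.one_apply]
    split_ifs with hyz'
    · rw [hvg, hyz', IncidenceAlgebra.add_apply, hg, IncidenceAlgebra.one_apply, if_pos rfl,
        add_zero]
    · have h3 := congrArg (fun f : IncidenceAlgebra F X => f y z) (hcomm y)
      simp only [IncidenceAlgebra.mul_idem_apply, IncidenceAlgebra.idem_mul_apply] at h3
      rw [if_neg (Ne.symm hyz'), if_true] at h3
      exact h3.symm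
  obtain rfl : v = 1 := Units.ext hv1
  refine Theta_injective (MulOpposite.unop_injective (AlgEquiv.ext fun f => ?_))
  rw [map_one]
  exact (hv f).trans (by simp)

theorem innerCoalgAutOne_normal : (innerCoalgAutOne F X).Normal where
  conj_mem ν hν φ := by
    obtain ⟨v, g, hg, hvg, hv⟩ := hν
    let T := (Theta F X φ⁻¹).unop
    obtain ⟨τ, hτ⟩ := exists_Theta_apply_perm φ⁻¹
    refine ⟨Units.map (T : _ →* IncidenceAlgebra F X) v, T g, fun x => ?_, ?_, fun f => ?_⟩
    · obtain ⟨z, rfl⟩ := τ.surjective x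
      exact (hτ g z).trans (hg z)
    · change T v = _
      rw [hvg, map_add, map_one]
    · change (Theta F X (φ * ν * φ⁻¹)).unop f = T _ * f * T _
      rw [Theta_mul_apply, Theta_mul_apply]
      have h1 : (Theta F X ν).unop ((Theta F X φ).unop f) = _ := hv _
      rw [h1, map_mul, map_mul, Theta_apply_inv]
      rfl

theorem orderAut_conj_mem_multAut {ρ φ : IncidenceCoalgebra F X ≃ₗc[F] IncidenceCoalgebra F X}
    (hρ : ρ ∈ orderAut F X) (hφ : φ ∈ multAut F X) : ρ * φ * ρ⁻¹ ∈ multAut F X := by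
  obtain ⟨σ, hσ⟩ := hρ
  obtain ⟨d, hd, h1, h2⟩ := hφ
  have hσ' : ∀ x y, x ≤ y → ρ⁻¹ (interval F x y) = interval F (σ.symm x) (σ.symm y) := by
    intro x y h
    change ρ.symm _ = _
    apply (EquivLike.injective ρ)
    rw [CoalgEquiv.apply_symm_apply, hσ _ _ (σ.symm.monotone h)]
    simp
  -- a multiplicative system has arbitrary values on the diagonal, so `1` is put there by hand
  refine mem_multAut_of_apply_interval
    (d := fun x y => if x = y then 1 else d (σ.symm x) (σ.symm y)) (fun x y h => ?_)
    fun x y h => ?_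
  · rw [if_neg h.ne]
    exact hd.ne_zero _ _ (σ.symm.strictMono h)
  · change ρ (φ (ρ⁻¹ _)) = _
    rw [hσ' x y h]
    obtain rfl | hlt := eq_or_lt_of_le h
    · rw [h1, hσ _ _ le_rfl, if_pos rfl, one_smul, OrderIso.apply_symm_apply]
    · rw [h2 _ _ (σ.symm.strictMono hlt), map_smul, hσ _ _ (σ.symm.monotone h), if_neg hlt.ne,
        OrderIso.apply_symm_apply, OrderIso.apply_symm_apply]

/-- The coalgebra form of `IncidenceAlgebra.exists_unit_conj_apply_eq_mul`. -/
theorem exists_mul_mul_eq (φ : IncidenceCoalgebra F X ≃ₗc[F] IncidenceCoalgebra F X) :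
    ∃ ν ∈ innerCoalgAutOne F X, ∃ μ ∈ multAut F X, ∃ ρ ∈ orderAut F X, ν * (μ * ρ) = φ := by
  obtain ⟨v, σ, c, hv, hc, h⟩ := IncidenceAlgebra.exists_unit_conj_apply_eq_mul (Theta F X φ).unop
  let I : IncidenceAlgebra F X ≃ₐ[F] IncidenceAlgebra F X :=
    MulSemiringAction.toAlgEquiv F (IncidenceAlgebra F X) (ConjAct.toConjAct v)
  obtain ⟨α, hα⟩ := Theta_surjective (MulOpposite.op I)
  have hαI : ∀ f, (Theta F X α).unop f = ↑v * f * ↑v⁻¹ := fun f => by rw [hα]; rfl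
  have hα1 : α⁻¹ ∈ innerCoalgAutOne F X := by
    refine ⟨v, ↑v - 1, fun x => ?_, by abel, fun f => ?_⟩
    · rw [IncidenceAlgebra.sub_apply, hv, IncidenceAlgebra.one_apply, if_pos rfl, sub_self]
    · have h1 := Theta_apply_inv α (↑v⁻¹ * f * ↑v)
      rw [hαI] at h1
      simpa [mul_assoc] using h1
  obtain ⟨ρ, hρ, hρσ⟩ := exists_mem_orderAut (F := F) σ
  have hφα : ∀ x y, x ≤ y → (φ * α) (interval F x y) = c x y • interval F (σ x) (σ y) :=
    fun x y _ => apply_interval_of_Theta fun f => by rw [Theta_mul_apply, hαI, h]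
  have hμ : φ * α * ρ⁻¹ ∈ multAut F X := by
    refine mem_multAut_of_apply_interval (d := fun x y => c (σ.symm x) (σ.symm y))
      (fun x y hxy => hc _ _ (σ.symm.monotone hxy.le)) fun x y hxy => ?_
    have h1 : interval F x y = ρ (interval F (σ.symm x) (σ.symm y)) := by
      rw [hρσ _ _ (σ.symm.monotone hxy), OrderIso.apply_symm_apply, OrderIso.apply_symm_apply]
    have h2 : (φ * α * ρ⁻¹) (interval F x y) = (φ * α) (interval F (σ.symm x) (σ.symm y)) := by
      rw [h1]
      exact congrArg (φ * α) (ρ.symm_apply_apply _)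
    rw [h2, hφα _ _ (σ.symm.monotone hxy), OrderIso.apply_symm_apply, OrderIso.apply_symm_apply]
  -- the factor `α⁻¹` appears on the right and is moved to the left by normality
  have hconj : φ * α * α⁻¹ * (φ * α)⁻¹ ∈ innerCoalgAutOne F X :=
    innerCoalgAutOne_normal.conj_mem _ hα1 (φ * α)
  exact ⟨_, hconj, _, hμ, ρ, hρ, by group⟩

end IncidenceCoalgebra

theorem theorem8p1 (F : Type*) [Field F] (X : Type*) [PartialOrder X] [LocallyFiniteOrder X]
    [DecidableEq X] :
    -- `In(Aut C) · Mult C` is a subgroup, and `Aut C = (In(Aut C) · Mult C) ⋊ Aut_C X`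
    (∃ P : Subgroup (IncidenceCoalgebra F X ≃ₗc[F] IncidenceCoalgebra F X),
      (P : Set (IncidenceCoalgebra F X ≃ₗc[F] IncidenceCoalgebra F X)) =
        (innerCoalgAut F (IncidenceCoalgebra F X) : Set _) *
          (IncidenceCoalgebra.multAut F X : Set _) ∧
      IsInternalSemidirect ⊤ P (IncidenceCoalgebra.orderAut F X) ∧
      -- `Aut C = (In₁(Aut C) ⋊ Mult C) ⋊ Aut_C X`
      IsInternalSemidirect P (IncidenceCoalgebra.innerCoalgAutOne F X)
        (IncidenceCoalgebra.multAut F X)) ∧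
    -- `Aut C = In₁(Aut C) ⋊ (Mult C ⋊ Aut_C X)`
    (∃ Q : Subgroup (IncidenceCoalgebra F X ≃ₗc[F] IncidenceCoalgebra F X),
      IsInternalSemidirect ⊤ (IncidenceCoalgebra.innerCoalgAutOne F X) Q ∧
      IsInternalSemidirect Q (IncidenceCoalgebra.multAut F X)
        (IncidenceCoalgebra.orderAut F X)) ∧
    -- `Θ` is an anti-isomorphism from `Aut C` onto `Aut I(X,F)`
    (∃ e : (IncidenceCoalgebra F X ≃ₗc[F] IncidenceCoalgebra F X) ≃*
        (IncidenceAlgebra F X ≃ₐ[F] IncidenceAlgebra F X)ᵐᵒᵖ,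
      e.toMonoidHom = IncidenceCoalgebra.Theta F X) := by
  open IncidenceCoalgebra in
  obtain ⟨hP, hPH, hPNM, hNQ, hQ⟩ := IsInternalSemidirect.of_three_factors
    (innerCoalgAutOne_le_innerCoalgAut.trans innerCoalgAut_le_diagFixing)
    multAut_le_diagFixing innerCoalgAutOne_normal diagFixing_normal
    (fun _ hρ _ hφ => orderAut_conj_mem_multAut hρ hφ)
    (fun _ => eq_one_of_mem_innerCoalgAutOne_of_mem_multAut (F := F) (X := X))
    (fun _ => eq_one_of_mem_diagFixing_of_mem_orderAut) exists_mul_mul_eq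
  refine ⟨⟨diagFixing F X, ?_, hPH, hPNM⟩, ⟨_, hNQ, hQ⟩,
    ⟨MulEquiv.ofBijective (Theta F X) ⟨Theta_injective, Theta_surjective⟩, rfl⟩⟩
  refine Set.Subset.antisymm (fun φ hφ => ?_) ?_
  · obtain ⟨ν, hν, μ, hμ, rfl⟩ := hP φ hφ
    exact Set.mul_mem_mul (innerCoalgAutOne_le_innerCoalgAut hν) hμ
  · rintro _ ⟨ν, hν, μ, hμ, rfl⟩
    exact mul_mem (innerCoalgAut_le_diagFixing hν) (multAut_le_diagFixing hμ)
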